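/- All algebras are complex and associative. A \emph{norm} on an algebra $A$ is a vector space norm $|\cdot|$ with $|ab|\le |a||b|$ for all $a,b\in A$; it need not be complete, nor related to a norm already given on $A$. A norm $p$ \emph{majorizes} a norm $q$ if $q(a)\le p(a)$ for all $a$; a norm $|\cdot|$ is \emph{minimal} if every norm that it majorizes is equal to it. The \emph{permanent spectral radius} is $r_{pA}(a)=\inf\{|a| : |\cdot| \text{ is a norm on } A\}$, and a Banach algebra $A$ has the \emph{P-property} if every nonzero closed two-sided ideal of $A$ contains an element $a$ with $r_{pA}(a)>0$. A Banach algebra $A$ has the \emph{spectral extension property} (SEP) if $r_A(a)=r_B(a)$ for all $a\in A$ and every Banach algebra $B$ that contains $A$ as a (not necessarily closed) subalgebra, where $r$ denotes the spectral radius (computed in the unitization if there is no identity). $A$ is \emph{semisimple} if its Jacobson radical is zero. $A_e=A\oplus\mathbb C1$ is the unitization of $A$, with norm $\|a+\lambda1\|=\|a\|+|\lambda|$. \textbf{Theorem.} Let $A$ be a semisimple Banach algebra without an identity element, and assume that $A$ has SEP. Then: \begin{enumerate} \item $A$ has the P-property; \item every norm on $A$ majorizes a minimal norm on $A$; \item $A_e$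 has the P-property; \item every norm on $A_e$ majorizes a minimal norm on $A_e$; \item if $|\cdot|$ is a minimal norm on $A_e$, then the completion of $(A_e,|\cdot|)$ has the P-property. \end{enumerate} -/

import Mathlib

universe u

/-- The unitization `A ⊕ ℂ1` of a complex Banach algebra, with its (complete) `ℓ¹`-norm
`‖a + λ1‖ = ‖a‖ + |λ|`. -/
abbrev UnitizationAlg (A : Type*) [NonUnitalNormedRing A] [NormedSpace ℂ A] : Type _ :=
  WithLp 1 (Unitization ℂ A)

section Algebraic

variable {A : Type*} [NonUnitalRing A] [Module ℂ A]

/-- A (two-sided) identity element exists. -/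
def HasIdentity (A : Type*) [NonUnitalRing A] : Prop :=
  ∃ e : A, ∀ x : A, e * x = x ∧ x * e = x

/-- A left ideal of the complex algebra `A` (a linear subspace `L` with `A L ⊆ L`). -/
def IsLeftIdeal (L : Submodule ℂ A) : Prop :=
  ∀ x : A, ∀ y ∈ L, x * y ∈ L

/-- A two-sided ideal of the complex algebra `A`. -/
def IsIdeal (I : Submodule ℂ A) : Prop :=
  ∀ x : A, ∀ y ∈ I, x * y ∈ I ∧ y * x ∈ I

/-- A modular left ideal: there is a right identity modulo `L`. -/
def IsModularLeftIdeal (L : Submodule ℂ A) : Prop :=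
  IsLeftIdeal L ∧ ∃ u : A, ∀ x : A, x - x * u ∈ L

/-- A maximal modular left ideal: modular, and maximal among the proper left ideals. -/
def IsMaximalModularLeftIdeal (L : Submodule ℂ A) : Prop :=
  IsModularLeftIdeal L ∧ Maximal (fun J : Submodule ℂ A => IsLeftIdeal J ∧ J ≠ ⊤) L

/-- `A` is semisimple: its Jacobson radical, the intersection of all maximal modular left ideals
(all of `A` if there are none), is zero. -/
def IsSemisimpleAlg (A : Type*) [NonUnitalRing A] [Module ℂ A] : Prop :=
  ∀ a : A, (∀ L : Submodule ℂ A, IsMaximalModularLeftIdeal L → a ∈ L) → a = 0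

/-- The spectral radius `r_A(a)`. For an algebra without identity the spectrum of `a` is taken in
the unitization; the quasispectrum is exactly this set (for an algebra with identity it is the
spectrum together with `0`, which does not change the radius). -/
noncomputable def specRad (a : A) : ENNReal :=
  ⨆ z ∈ quasispectrum ℂ a, (‖z‖₊ : ENNReal)

/-- A norm on the complex algebra `A`: a submultiplicative vector space norm. No completeness, and
no relation to any norm that `A` already carries, is required. -/
def IsAlgebraNorm (p : Seminorm ℂ A) : Prop :=
  (∀ a : A, p a = 0 → a = 0) ∧ ∀ a b : A, p (a * b) ≤ p a * p b

/-- A minimal norm: a norm `p` such that every norm `q` with `q ≤ p` pointwise equals `p`. -/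
def IsMinimalNorm (p : Seminorm ℂ A) : Prop :=
  Minimal IsAlgebraNorm p

/-- The permanent spectral radius `r_{pA}(a) = inf {|a| : |·| a norm on A}`. -/
noncomputable def permanentRadius (a : A) : ℝ :=
  sInf {t : ℝ | ∃ p : Seminorm ℂ A, IsAlgebraNorm p ∧ t = p a}

end Algebraic

/-- The spectral extension property: the spectral radius of every element of `A` is the same in
every Banach algebra `B` that contains `A` as a (not necessarily closed) subalgebra. The embedding
is purely algebraic, with no continuity. -/
def HasSEP (A : Type u) [NonUnitalRing A] [Module ℂ A] : Prop :=
  ∀ (B : Type u) [NonUnitalNormedRing B] [NormedSpace ℂ B] [IsScalarTower ℂ B B]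
    [SMulCommClass ℂ B B] [CompleteSpace B] (φ : A →ₙₐ[ℂ] B),
    Function.Injective φ → ∀ a : A, specRad a = specRad (φ a)

/-- The P-property: every nonzero closed two-sided ideal contains an element with positive
permanent spectral radius. -/
def HasPProperty (A : Type*) [NonUnitalNormedRing A] [NormedSpace ℂ A] : Prop :=
  ∀ I : Submodule ℂ A, IsIdeal I → IsClosed (I : Set A) → I ≠ ⊥ →
    ∃ a ∈ I, 0 < permanentRadius a

/-- Scalars and products are compatible in the completion of a normed algebra. -/
theorem completion_smul_mul {S : Type*} [NormedRing S] [NormedAlgebra ℂ S] (c : ℂ)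
    (x y : UniformSpace.Completion S) : (c • x) * y = c • (x * y) := by
  refine UniformSpace.Completion.induction_on₂ x y
    (isClosed_eq ((continuous_fst.const_smul c).mul continuous_snd)
      ((continuous_fst.mul continuous_snd).const_smul c)) fun a b => ?_
  rw [← UniformSpace.Completion.coe_smul, ← UniformSpace.Completion.coe_mul,
    ← UniformSpace.Completion.coe_mul, ← UniformSpace.Completion.coe_smul, smul_mul_assoc]

theorem completion_mul_smul {S : Type*} [NormedRing S] [NormedAlgebra ℂ S] (c : ℂ)
    (x y : UniformSpace.Completion S) : x * (c • y) = c • (x * y) := by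
  refine UniformSpace.Completion.induction_on₂ x y
    (isClosed_eq (continuous_fst.mul (continuous_snd.const_smul c))
      ((continuous_fst.mul continuous_snd).const_smul c)) fun a b => ?_
  rw [← UniformSpace.Completion.coe_smul, ← UniformSpace.Completion.coe_mul,
    ← UniformSpace.Completion.coe_mul, ← UniformSpace.Completion.coe_smul, mul_smul_comm]

section Completion

variable {R : Type*} [Ring R] [Algebra ℂ R]

/-- The normed algebra `(R, p)`: a copy of `R` that carries the norm `p`. -/
def NormedCopy (p : Seminorm ℂ R) (_hp : IsAlgebraNorm p) : Type _ := R

variable (p : Seminorm ℂ R) (hp : IsAlgebraNorm p)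

instance NormedCopy.instRing : Ring (NormedCopy p hp) := inferInstanceAs (Ring R)

instance NormedCopy.instAlgebra : Algebra ℂ (NormedCopy p hp) := inferInstanceAs (Algebra ℂ R)

/-- The norm `p`, as a ring norm on the copy. -/
noncomputable def NormedCopy.ringNorm : RingNorm (NormedCopy p hp) where
  toFun := fun x => p (show R from x)
  map_zero' := map_zero p
  add_le' := fun x y => map_add_le_add p (show R from x) (show R from y)
  neg' := fun x => map_neg_eq_map p (show R from x)
  mul_le' := fun x y => hp.2 (show R from x) (show R from y)
  eq_zero_of_map_eq_zero' := fun x hx => hp.1 (show R from x) hx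

noncomputable instance NormedCopy.instNormedRing : NormedRing (NormedCopy p hp) :=
  RingNorm.toNormedRing (NormedCopy.ringNorm p hp)

theorem NormedCopy.norm_def (x : R) : ‖(show NormedCopy p hp from x)‖ = p x := rfl

noncomputable instance NormedCopy.instNormedAlgebra : NormedAlgebra ℂ (NormedCopy p hp) where
  norm_smul_le := fun c x => le_of_eq (map_smul_eq_mul p c (show R from x))

/-- The completion of the normed algebra `(R, p)`, a Banach algebra. -/
abbrev NormCompletion : Type _ := UniformSpace.Completion (NormedCopy p hp)

instance NormCompletion.instIsScalarTower :
    IsScalarTower ℂ (NormCompletion p hp) (NormCompletion p hp) where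
  smul_assoc := completion_smul_mul

instance NormCompletion.instSMulCommClass :
    SMulCommClass ℂ (NormCompletion p hp) (NormCompletion p hp) where
  smul_comm := fun c x y => (completion_mul_smul c x y).symm

end Completion

/-! Everything rests on one uniform bound: each nonzero ideal of `A`, closed or not, contains an `a`
with `p a ≥ 1` for every algebra norm `p`. By semisimplicity the ideal contains an `a` whose
quasispectrum contains 1; SEP, applied to a completion for `p`, bounds that spectral value by `p a`.

The bound (`IsPermanentlyPositive`) gives the P-property at once. It also gives minimal norms by
Zorn: the infimum of a chain of norms is a submultiplicative seminorm whose kernel is an ideal,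
hence zero. No closedness can be asked of this kernel, so the bound is needed for all ideals.

The bound moves up an injection as soon as nonzero ideals above have nonzero preimage. For `A ⊆ A_e`
this holds because `A` has no identity; for `A_e` in its completion, with closed ideals, because the
norm is minimal. -/

open UniformSpace

/-! ### Uniform positivity over all norms, and minimal norms by Zorn -/

section PermanentlyPositive

variable {R S : Type*} [NonUnitalRing R] [Module ℂ R] [NonUnitalRing S] [Module ℂ S]

/-- Some element of `I` is bounded away from `0` uniformly in all algebra norms. -/
def IsPermanentlyPositive (I : Submodule ℂ R) : Prop :=
  ∃ a ∈ I, ∃ c : ℝ, 0 < c ∧ ∀ p : Seminorm ℂ R, IsAlgebraNorm p → c ≤ p a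

theorem IsAlgebraNorm.comp {p : Seminorm ℂ S} (hp : IsAlgebraNorm p) (φ : R →ₙₐ[ℂ] S)
    (hφ : Function.Injective φ) : IsAlgebraNorm (p.comp (φ : R →ₗ[ℂ] S)) := by
  refine ⟨fun a ha => hφ ?_, fun a b => ?_⟩
  · rw [map_zero]
    exact hp.1 _ ha
  · have h := hp.2 (φ a) (φ b)
    rw [← map_mul] at h
    exact h

theorem IsIdeal.comap {I : Submodule ℂ S} (hI : IsIdeal I) (φ : R →ₙₐ[ℂ] S) :
    IsIdeal (I.comap (φ : R →ₗ[ℂ] S)) := by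
  intro x y hy
  have h := hI (φ x) (φ y) hy
  rw [← map_mul, ← map_mul] at h
  exact h

/-- Norms on `S` restrict to norms on `R`, so the same constant serves upstairs. -/
theorem IsPermanentlyPositive.of_comap {I : Submodule ℂ S} (φ : R →ₙₐ[ℂ] S)
    (hφ : Function.Injective φ) (h : IsPermanentlyPositive (I.comap (φ : R →ₗ[ℂ] S))) :
    IsPermanentlyPositive I := by
  obtain ⟨a, ha, c, hc, hcp⟩ := h
  exact ⟨φ a, ha, c, hc, fun p hp => hcp _ (hp.comp φ hφ)⟩

theorem exists_isMinimalNorm_le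
    (hR : ∀ I : Submodule ℂ R, IsIdeal I → I ≠ ⊥ → IsPermanentlyPositive I)
    (p : Seminorm ℂ R) (hp : IsAlgebraNorm p) :
    ∃ q : Seminorm ℂ R, IsMinimalNorm q ∧ q ≤ p := by
  suffices hinf : ∀ C : Set (Seminorm ℂ R), (∀ q ∈ C, IsAlgebraNorm q) →
      IsChain (fun q₁ q₂ => q₂ ≤ q₁) C → ∀ q₀ ∈ C, ∃ m, IsAlgebraNorm m ∧ ∀ q ∈ C, m ≤ q by
    obtain ⟨q, hqp, hq⟩ := @zorn_le_nonempty₀ (Seminorm ℂ R)ᵒᵈ _ {q | IsAlgebraNorm q} hinf p hp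
    exact ⟨q, hq, hqp⟩
  intro C hC hchain p₀ hp₀
  have hne : Nonempty C := ⟨⟨p₀, hp₀⟩⟩
  have hbdd (x : R) : BddBelow (Set.range fun q : C => (q : Seminorm ℂ R) x) :=
    ⟨0, by rintro _ ⟨q, rfl⟩; exact apply_nonneg _ _⟩
  have hlt {x : R} {s : ℝ} (h : ⨅ q : C, (q : Seminorm ℂ R) x < s) :
      ∃ q : C, (q : Seminorm ℂ R) x < s := exists_lt_of_ciInf_lt h
  -- A chain is directed downwards: near-optimal norms for two elements can be replaced by a single
  -- one, which is what makes the infimum subadditive and submultiplicative.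
  have hcommon (q₁ q₂ : C) : ∃ q : C, (∀ x, (q : Seminorm ℂ R) x ≤ (q₁ : Seminorm ℂ R) x) ∧
      ∀ x, (q : Seminorm ℂ R) x ≤ (q₂ : Seminorm ℂ R) x := by
    rcases hchain.total q₁.2 q₂.2 with h | h
    · exact ⟨q₂, fun x => h x, fun x => le_rfl⟩
    · exact ⟨q₁, fun x => le_rfl, fun x => h x⟩
  let m : Seminorm ℂ R := Seminorm.of (fun x => ⨅ q : C, (q : Seminorm ℂ R) x)
    (by
      refine fun x y => le_of_forall_pos_le_add fun ε hε => ?_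
      obtain ⟨q₁, h₁⟩ := hlt (lt_add_of_pos_right (⨅ q : C, (q : Seminorm ℂ R) x) (half_pos hε))
      obtain ⟨q₂, h₂⟩ := hlt (lt_add_of_pos_right (⨅ q : C, (q : Seminorm ℂ R) y) (half_pos hε))
      obtain ⟨q, hq₁, hq₂⟩ := hcommon q₁ q₂
      have h := ciInf_le (hbdd (x + y)) q
      have h' := map_add_le_add (q : Seminorm ℂ R) x y
      linarith [hq₁ x, hq₂ y])
    (by
      intro c x
      simp only [map_smul_eq_mul]
      rw [Real.mul_iInf_of_nonneg (norm_nonneg c)])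
  have hm (x : R) : m x = ⨅ q : C, (q : Seminorm ℂ R) x := rfl
  have hmle (q : C) (x : R) : m x ≤ (q : Seminorm ℂ R) x := ciInf_le (hbdd x) q
  have hmul (a b : R) : m (a * b) ≤ m a * m b := by
    have key : ∀ s t : ℝ, m a < s → m b < t → m (a * b) ≤ s * t := by
      intro s t hs ht
      obtain ⟨q₁, h₁⟩ := hlt hs
      obtain ⟨q₂, h₂⟩ := hlt ht
      obtain ⟨q, hq₁, hq₂⟩ := hcommon q₁ q₂
      calc m (a * b) ≤ (q : Seminorm ℂ R) (a * b) := hmle q _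
        _ ≤ (q : Seminorm ℂ R) a * (q : Seminorm ℂ R) b := (hC q q.2).2 a b
        _ ≤ s * t := mul_le_mul ((hq₁ a).trans h₁.le) ((hq₂ b).trans h₂.le) (apply_nonneg _ _)
            ((apply_nonneg _ _).trans h₁.le)
    exact le_mul_of_forall_lt₀ fun s hs t ht => key s t hs ht
  refine ⟨m, ⟨?_, hmul⟩, fun q hq x => hmle ⟨q, hq⟩ x⟩
  let K : Submodule ℂ R :=
    { carrier := {x | m x = 0}
      add_mem' := fun {x y} hx hy => le_antisymm
        ((map_add_le_add m x y).trans_eq (by rw [hx.out, hy.out, add_zero])) (apply_nonneg _ _)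
      zero_mem' := map_zero m
      smul_mem' := fun c x hx => by
        rw [Set.mem_ofPred_eq, map_smul_eq_mul, hx.out, mul_zero] }
  have hK : IsIdeal K := fun x y hy =>
    ⟨le_antisymm ((hmul x y).trans_eq (by rw [hy.out, mul_zero])) (apply_nonneg _ _),
      le_antisymm ((hmul y x).trans_eq (by rw [hy.out, zero_mul])) (apply_nonneg _ _)⟩
  intro a ha
  by_contra hne0
  obtain ⟨b, hb, c, hc, hcb⟩ := hR K hK fun h => hne0 ((Submodule.mem_bot ℂ).1 (h ▸ ha))
  have : c ≤ m b := le_ciInf fun q => hcb q (hC q q.2)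
  exact hc.not_ge (this.trans_eq hb)

end PermanentlyPositive

theorem isAlgebraNorm_normSeminorm (B : Type*) [NonUnitalNormedRing B] [NormedSpace ℂ B] :
    IsAlgebraNorm (normSeminorm ℂ B) :=
  ⟨fun _ ha => norm_eq_zero.1 ha, fun a b => norm_mul_le a b⟩

theorem hasPProperty_of_isPermanentlyPositive {B : Type*} [NonUnitalNormedRing B]
    [NormedSpace ℂ B] (h : ∀ I : Submodule ℂ B, IsIdeal I → IsClosed (I : Set B) → I ≠ ⊥ →
      IsPermanentlyPositive I) : HasPProperty B := by
  intro I hI hIc hI0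
  obtain ⟨a, ha, c, hc, hcp⟩ := h I hI hIc hI0
  refine ⟨a, ha, hc.trans_le (le_csInf ⟨_, _, isAlgebraNorm_normSeminorm B, rfl⟩ ?_)⟩
  rintro _ ⟨p, hp, rfl⟩
  exact hcp p hp

/-! ### Spectral values in ideals, and their bound by every norm -/

section Spectrum

/-- A two-sided ideal consisting of quasinilpotent elements lies in the radical. -/
theorem IsIdeal.exists_mem_quasispectrum {A : Type*} [NonUnitalRing A] [Module ℂ A]
    (hA : IsSemisimpleAlg A) {I : Submodule ℂ A} (hI : IsIdeal I) (hI0 : I ≠ ⊥) :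
    ∃ a ∈ I, (1 : ℂ) ∈ quasispectrum ℂ a := by
  by_contra! hcon
  refine hI0 ((Submodule.eq_bot_iff I).2 fun a ha => hA a ?_)
  rintro L ⟨⟨hL, u, hu⟩, hmax⟩
  by_contra haL
  have hsup : IsLeftIdeal (L ⊔ I) := by
    intro x y hy
    obtain ⟨l, hl, i, hi, rfl⟩ := Submodule.mem_sup.1 hy
    rw [mul_add]
    exact Submodule.add_mem_sup (hL x l hl) (hI x i hi).1
  have htop : L ⊔ I = ⊤ := by
    by_contra hne
    exact haL (hmax.2 ⟨hsup, hne⟩ le_sup_left (Submodule.mem_sup_right ha))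
  obtain ⟨l, hl, c, hc, hlc⟩ := Submodule.mem_sup.1 (htop ▸ Submodule.mem_top : u ∈ L ⊔ I)
  -- Since `u = l + c` with `l ∈ L`, the element `c` of `I` is again a right identity modulo `L`.
  have hcL (x : A) : x - x * c ∈ L := by
    have h : x - x * c = (x - x * u) + x * l := by rw [← hlc, mul_add]; abel
    rw [h]
    exact L.add_mem (hu x) (hL x l hl)
  have hq := hcon c hc
  simp only [quasispectrum, Set.mem_ofPred_eq, not_forall, not_not] at hq
  obtain ⟨h1, hq⟩ := hq
  have hu1 : h1.unit = 1 := Units.ext rfl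
  rw [hu1, inv_one, one_smul] at hq
  obtain ⟨y, -, hy⟩ := isQuasiregular_iff.1 hq
  -- With `y` a quasi-inverse of `-c`, this puts `c` in `L`, which forces `L = ⊤`.
  have hcy : c = y - y * c := by
    rw [mul_neg] at hy
    rw [← sub_eq_zero, ← neg_eq_zero, ← hy]
    abel
  have hc' : c ∈ L := by
    rw [hcy]
    exact hcL y
  refine hmax.1.2 ((Submodule.eq_top_iff').2 fun x => ?_)
  have := L.add_mem (hcL x) (hL x c hc')
  rwa [sub_add_cancel] at this

variable {A : Type u} [NonUnitalRing A] [Module ℂ A]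

/-- The extension `a + λ1 ↦ p a + |λ|` of a seminorm to the unitization. -/
noncomputable def unitizationSeminorm (p : Seminorm ℂ A) : Seminorm ℂ (Unitization ℂ A) :=
  Seminorm.of (fun x => p x.snd + ‖x.fst‖)
    (fun x y => by
      have h₁ := map_add_le_add p x.snd y.snd
      have h₂ := norm_add_le x.fst y.fst
      simp only [Unitization.snd_add, Unitization.fst_add]
      linarith)
    (fun c x => by
      simp only [Unitization.snd_smul, Unitization.fst_smul, map_smul_eq_mul, norm_smul, mul_add])

theorem unitizationSeminorm_apply (p : Seminorm ℂ A) (x : Unitization ℂ A) :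
    unitizationSeminorm p x = p x.snd + ‖x.fst‖ := rfl

variable [IsScalarTower ℂ A A] [SMulCommClass ℂ A A]

theorem isAlgebraNorm_unitizationSeminorm {p : Seminorm ℂ A} (hp : IsAlgebraNorm p) :
    IsAlgebraNorm (unitizationSeminorm p) := by
  refine ⟨fun x hx => ?_, fun x y => ?_⟩
  · rw [unitizationSeminorm_apply] at hx
    have h₁ := apply_nonneg p x.snd
    have h₂ := norm_nonneg x.fst
    exact Unitization.ext (norm_eq_zero.1 (by linarith)) (hp.1 _ (by linarith))
  · simp only [unitizationSeminorm_apply, Unitization.snd_mul, Unitization.fst_mul, norm_mul]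
    have h₁ := map_add_le_add p (x.fst • y.snd + y.fst • x.snd) (x.snd * y.snd)
    have h₂ := map_add_le_add p (x.fst • y.snd) (y.fst • x.snd)
    rw [map_smul_eq_mul, map_smul_eq_mul] at h₂
    have h₃ := hp.2 x.snd y.snd
    linarith

/-- The canonical map into the completion of a normed algebra. -/
noncomputable def toNormCompletion {R : Type*} [Ring R] [Algebra ℂ R] (p : Seminorm ℂ R)
    (hp : IsAlgebraNorm p) : R →ₙₐ[ℂ] NormCompletion p hp where
  toFun x := ((show NormedCopy p hp from x : NormedCopy p hp) : NormCompletion p hp)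
  map_smul' c x := Completion.coe_smul c (show NormedCopy p hp from x)
  map_zero' := Completion.coe_zero
  map_add' x y :=
    Completion.coe_add (show NormedCopy p hp from x) (show NormedCopy p hp from y)
  map_mul' x y :=
    Completion.coe_mul (show NormedCopy p hp from x) (show NormedCopy p hp from y)

theorem norm_toNormCompletion {R : Type*} [Ring R] [Algebra ℂ R] (p : Seminorm ℂ R)
    (hp : IsAlgebraNorm p) (x : R) : ‖toNormCompletion p hp x‖ = p x :=
  Completion.norm_coe (show NormedCopy p hp from x)

theorem toNormCompletion_injective {R : Type*} [Ring R] [Algebra ℂ R] (p : Seminorm ℂ R)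
    (hp : IsAlgebraNorm p) : Function.Injective (toNormCompletion p hp) := by
  refine (injective_iff_map_eq_zero _).2 fun x hx => hp.1 x ?_
  rw [← norm_toNormCompletion p hp, hx, norm_zero]

theorem denseRange_toNormCompletion {R : Type*} [Ring R] [Algebra ℂ R] (p : Seminorm ℂ R)
    (hp : IsAlgebraNorm p) : DenseRange (toNormCompletion p hp) :=
  Completion.denseRange_coe (α := NormedCopy p hp)

theorem specRad_le_nnnorm {B : Type*} [NormedRing B] [NormedSpace ℂ B] [IsScalarTower ℂ B B]
    [SMulCommClass ℂ B B] [CompleteSpace B] (hone : ‖(1 : B)‖ = 1) (b : B) :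
    specRad b ≤ (‖b‖₊ : ENNReal) := by
  let : NormedAlgebra ℂ B :=
    { Algebra.ofModule smul_mul_assoc mul_smul_comm with norm_smul_le := norm_smul_le }
  refine iSup₂_le fun w hw => ?_
  rcases (quasispectrum_eq_spectrum_union_zero ℂ b).le hw with hw | rfl
  · have := spectrum.norm_le_norm_mul_of_mem hw
    rw [hone, mul_one] at this
    exact_mod_cast this
  · simp

/-- Under SEP the quasispectrum is bounded by every algebra norm. -/
theorem HasSEP.norm_le_of_mem_quasispectrum (hA : HasSEP A) {p : Seminorm ℂ A}
    (hp : IsAlgebraNorm p) {a : A} {z : ℂ} (hz : z ∈ quasispectrum ℂ a) : ‖z‖ ≤ p a := by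
  -- Adjoining a unit of norm 1 before completing lets the norm bound the spectrum with no extra
  -- factor.
  let P := unitizationSeminorm p
  have hP : IsAlgebraNorm P := isAlgebraNorm_unitizationSeminorm hp
  let φ : A →ₙₐ[ℂ] NormCompletion P hP :=
    (toNormCompletion P hP).comp (Unitization.inrNonUnitalAlgHom ℂ A)
  have hφ : Function.Injective φ :=
    (toNormCompletion_injective P hP).comp Unitization.inr_injective
  have hnorm : ‖φ a‖ = p a := by
    refine (norm_toNormCompletion P hP _).trans ?_
    simp [P, unitizationSeminorm_apply]
  have hone : ‖(1 : NormCompletion P hP)‖ = 1 := by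
    refine (norm_toNormCompletion P hP 1).trans ?_
    simp [P, unitizationSeminorm_apply]
  have h : (‖z‖₊ : ENNReal) ≤ ‖φ a‖₊ := by
    refine le_trans ?_ (specRad_le_nnnorm hone (φ a))
    rw [← hA _ φ hφ a]
    exact le_iSup₂ (f := fun (w : ℂ) (_ : w ∈ quasispectrum ℂ a) => (‖w‖₊ : ENNReal)) z hz
  rw [← hnorm]
  exact_mod_cast h

theorem IsIdeal.isPermanentlyPositive (hss : IsSemisimpleAlg A) (hSEP : HasSEP A)
    {I : Submodule ℂ A} (hI : IsIdeal I) (hI0 : I ≠ ⊥) : IsPermanentlyPositive I := by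
  obtain ⟨a, ha, h1⟩ := hI.exists_mem_quasispectrum hss hI0
  refine ⟨a, ha, 1, one_pos, fun p hp => ?_⟩
  simpa using hSEP.norm_le_of_mem_quasispectrum hp h1

end Spectrum

/-! ### Ideals of the unitization -/

section Unitization

variable {A : Type*} [NonUnitalNormedRing A] [NormedSpace ℂ A] [IsScalarTower ℂ A A]
  [SMulCommClass ℂ A A]

/-- The inclusion of `A` into its unitization. -/
noncomputable def toUnitizationAlg (A : Type*) [NonUnitalNormedRing A] [NormedSpace ℂ A]
    [IsScalarTower ℂ A A] [SMulCommClass ℂ A A] : A →ₙₐ[ℂ] UnitizationAlg A where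
  toFun x := WithLp.toLp 1 (x : Unitization ℂ A)
  map_smul' c x := by rw [Unitization.inr_smul]; rfl
  map_zero' := rfl
  map_add' x y := by rw [Unitization.inr_add]; rfl
  map_mul' x y := by rw [Unitization.inr_mul]; rfl

theorem toUnitizationAlg_injective : Function.Injective (toUnitizationAlg A) :=
  (WithLp.toLp_injective 1).comp Unitization.inr_injective

@[simp]
theorem ofLp_toUnitizationAlg (x : A) :
    WithLp.ofLp (toUnitizationAlg A x) = (x : Unitization ℂ A) := rfl

/-- A nonzero ideal of the unitization of an algebra without identity meets the algebra. -/
theorem IsIdeal.comap_toUnitizationAlg_ne_bot (hA : ¬ HasIdentity A)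
    {I : Submodule ℂ (UnitizationAlg A)} (hI : IsIdeal I) (hI0 : I ≠ ⊥) :
    I.comap (toUnitizationAlg A : A →ₗ[ℂ] UnitizationAlg A) ≠ ⊥ := by
  intro hbot
  have hzero (x : A) (hx : toUnitizationAlg A x ∈ I) : x = 0 :=
    (Submodule.mem_bot ℂ).1 (hbot ▸ hx)
  obtain ⟨b, hb, hb0⟩ := Submodule.exists_mem_ne_zero_of_ne_bot hI0
  set l : ℂ := (WithLp.ofLp b).fst with hl
  set a : A := (WithLp.ofLp b).snd with ha
  have hleft (x : A) : b * toUnitizationAlg A x = toUnitizationAlg A (l • x + a * x) := by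
    apply WithLp.ofLp_injective
    rw [WithLp.unitization_mul]
    apply Unitization.ext <;> simp [hl, ha]
  have hright (x : A) : toUnitizationAlg A x * b = toUnitizationAlg A (l • x + x * a) := by
    apply WithLp.ofLp_injective
    rw [WithLp.unitization_mul]
    apply Unitization.ext <;> simp [hl, ha, mul_comm]
  have hax (x : A) : l • x + a * x = 0 := hzero _ (hleft x ▸ (hI _ b hb).2)
  have hxa (x : A) : l • x + x * a = 0 := hzero _ (hright x ▸ (hI _ b hb).1)
  -- Either `b` already lies in `A`, or dividing by `l` turns `-a` into an identity of `A`.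
  by_cases hl0 : l = 0
  · have hba : b = toUnitizationAlg A a := by
      apply WithLp.ofLp_injective
      apply Unitization.ext <;> simp [← hl, hl0, ha]
    have ha0 := hzero a (hba ▸ hb)
    exact hb0 (by rw [hba, ha0, map_zero])
  · refine hA ⟨-(l⁻¹ • a), fun x => ⟨?_, ?_⟩⟩
    · rw [neg_mul, smul_mul_assoc, eq_neg_of_add_eq_zero_right (hax x), smul_neg, neg_neg,
        inv_smul_smul₀ hl0]
    · rw [mul_neg, mul_smul_comm, eq_neg_of_add_eq_zero_right (hxa x), smul_neg, neg_neg,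
        inv_smul_smul₀ hl0]

end Unitization

/-! ### Quotient norms and completions for minimal norms -/

/-- The quotient seminorm by a subspace. -/
noncomputable def quotientSeminorm {B : Type*} [NonUnitalNormedRing B] [NormedSpace ℂ B]
    (J : Submodule ℂ B) : Seminorm ℂ B :=
  (normSeminorm ℂ (B ⧸ J)).comp J.mkQ

theorem quotientSeminorm_apply {B : Type*} [NonUnitalNormedRing B] [NormedSpace ℂ B]
    (J : Submodule ℂ B) (x : B) : quotientSeminorm J x = ‖J.mkQ x‖ := rfl

/-- Multiply coset representatives of nearly minimal norm; the product represents the right coset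
because `J` is two-sided. -/
theorem quotientSeminorm_mul_le {B : Type*} [NonUnitalNormedRing B] [NormedSpace ℂ B]
    {J : Submodule ℂ B} (hJ : IsIdeal J) (x y : B) :
    quotientSeminorm J (x * y) ≤ quotientSeminorm J x * quotientSeminorm J y := by
  have hlift {x : B} {s : ℝ} (h : quotientSeminorm J x < s) :
      ∃ x' : B, x' - x ∈ J ∧ ‖x'‖ < s := by
    obtain ⟨x', hx', hs⟩ := Submodule.Quotient.norm_mk_lt (J.mkQ x) (sub_pos.2 h)
    refine ⟨x', (Submodule.Quotient.eq J).1 hx', ?_⟩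
    rwa [← quotientSeminorm_apply, add_sub_cancel] at hs
  refine le_mul_of_forall_lt₀ fun s hs t ht => ?_
  obtain ⟨x', hx, hxs⟩ := hlift hs
  obtain ⟨y', hy, hyt⟩ := hlift ht
  have hxy : J.mkQ (x * y) = J.mkQ (x' * y') := by
    refine ((Submodule.Quotient.eq J).2 ?_).symm
    have h : x' * y' - x * y = (x' - x) * y' + x * (y' - y) := by
      rw [sub_mul, mul_sub]; abel
    rw [h]
    exact J.add_mem (hJ y' _ hx).2 (hJ x _ hy).1
  rw [quotientSeminorm_apply, hxy]
  calc ‖J.mkQ (x' * y')‖ ≤ ‖x' * y'‖ := Submodule.Quotient.norm_mk_le J _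
    _ ≤ ‖x'‖ * ‖y'‖ := norm_mul_le _ _
    _ ≤ s * t := mul_le_mul hxs.le hyt.le (norm_nonneg _) ((norm_nonneg _).trans hxs.le)

/-- A nonzero closed ideal of the completion for a minimal norm meets the dense subalgebra. -/
theorem IsIdeal.comap_toNormCompletion_ne_bot {R : Type*} [Ring R] [Algebra ℂ R]
    {p : Seminorm ℂ R} (hp : IsMinimalNorm p) {J : Submodule ℂ (NormCompletion p hp.1)}
    (hJ : IsIdeal J) (hJc : IsClosed (J : Set (NormCompletion p hp.1))) (hJ0 : J ≠ ⊥) :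
    J.comap (toNormCompletion p hp.1 : R →ₗ[ℂ] NormCompletion p hp.1) ≠ ⊥ := by
  intro hbot
  let φ := toNormCompletion p hp.1
  let q : Seminorm ℂ R := (quotientSeminorm J).comp (φ : R →ₗ[ℂ] NormCompletion p hp.1)
  have hq (x : R) : q x = quotientSeminorm J (φ x) := rfl
  have hnorm : IsAlgebraNorm q := by
    refine ⟨fun x hx => ?_, fun x y => ?_⟩
    · rw [hq, quotientSeminorm_apply, norm_eq_zero, Submodule.mkQ_apply,
        Submodule.Quotient.mk_eq_zero] at hx
      exact (Submodule.mem_bot ℂ).1 (hbot ▸ hx)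
    · rw [hq, map_mul]
      exact quotientSeminorm_mul_le hJ _ _
  have hqp : q ≤ p := fun x =>
    (Submodule.Quotient.norm_mk_le J (φ x)).trans_eq (norm_toNormCompletion p hp.1 x)
  -- Minimality makes the quotient map isometric on the dense subalgebra, hence everywhere, so its
  -- kernel `J` vanishes.
  have hpq : p ≤ q := hp.2 hnorm hqp
  have hle (x : NormCompletion p hp.1) : ‖x‖ ≤ ‖J.mkQ x‖ := by
    refine (denseRange_toNormCompletion p hp.1).induction_on x
      (isClosed_le continuous_norm (continuous_norm.comp ?_)) fun a => ?_
    · exact AddMonoidHomClass.continuous_of_bound J.mkQ 1 fun x => by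
        rw [one_mul]
        exact Submodule.Quotient.norm_mk_le J x
    · exact (norm_toNormCompletion p hp.1 a).trans_le (hpq a)
  refine hJ0 ((Submodule.eq_bot_iff J).2 fun x hx => norm_le_zero_iff.1 ((hle x).trans_eq ?_))
  rw [Submodule.mkQ_apply, (Submodule.Quotient.mk_eq_zero J).2 hx, norm_zero]

theorem mainTheorem2 (A : Type u) [NonUnitalNormedRing A] [NormedSpace ℂ A]
    [IsScalarTower ℂ A A] [SMulCommClass ℂ A A] [CompleteSpace A]
    (hnonunital : ¬ HasIdentity A) (hsemisimple : IsSemisimpleAlg A) (hSEP : HasSEP A) :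
    HasPProperty A ∧
    (∀ p : Seminorm ℂ A, IsAlgebraNorm p → ∃ q : Seminorm ℂ A, IsMinimalNorm q ∧ q ≤ p) ∧
    HasPProperty (UnitizationAlg A) ∧
    (∀ p : Seminorm ℂ (UnitizationAlg A), IsAlgebraNorm p →
      ∃ q : Seminorm ℂ (UnitizationAlg A), IsMinimalNorm q ∧ q ≤ p) ∧
    (∀ (p : Seminorm ℂ (UnitizationAlg A)) (hp : IsMinimalNorm p),
      HasPProperty (NormCompletion p hp.1)) := by
  have hA (I : Submodule ℂ A) (hI : IsIdeal I) (hI0 : I ≠ ⊥) : IsPermanentlyPositive I :=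
    hI.isPermanentlyPositive hsemisimple hSEP hI0
  have hAe (I : Submodule ℂ (UnitizationAlg A)) (hI : IsIdeal I) (hI0 : I ≠ ⊥) :
      IsPermanentlyPositive I :=
    .of_comap _ toUnitizationAlg_injective
      (hA _ (hI.comap _) (hI.comap_toUnitizationAlg_ne_bot hnonunital hI0))
  refine ⟨hasPProperty_of_isPermanentlyPositive fun I hI _ => hA I hI, exists_isMinimalNorm_le hA,
    hasPProperty_of_isPermanentlyPositive fun I hI _ => hAe I hI, exists_isMinimalNorm_le hAe,
    fun p hp => hasPProperty_of_isPermanentlyPositive fun J hJ hJc hJ0 => ?_⟩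
  exact .of_comap _ (toNormCompletion_injective p hp.1)
    (hAe _ (hJ.comap _) (hJ.comap_toNormCompletion_ne_bot hp hJc hJ0))
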